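/- Let $0<s<1$ and $1<p<\infty$. A weight on $\mathbb R^n$ is a function $\omega\in L^1_{\mathrm{loc}}(\mathbb R^n)$ with $\omega>0$ almost everywhere; it is an $A_p$ weight if there is a constant $A>0$ with $$\Big(\frac1{|Q|}\int_Q\omega\,dx\Big)\Big(\frac1{|Q|}\int_Q\omega^{-1/(p-1)}\,dx\Big)^{p-1}\le A$$ for every cube $Q\subset\mathbb R^n$ (with sides parallel to the axes). For a weight $\omega$, let $W^{s,p,\omega}(\mathbb R^n)$ be the space of real-valued $f\in L^p(\mathbb R^n)$ with $$\|f\|_{W^{s,p,\omega}(\mathbb R^n)}^p=\|f\|_{L^p(\mathbb R^n)}^p+\int_{\mathbb R^n}\int_{\mathbb R^n}\frac{|f(x)-f(y)|^p}{|x-y|^{sp}}\,\omega(x-y)\,dy\,dx<\infty ,$$ and for $E\subset\mathbb R^n$ let $$C_{s,p,\omega}(E)=\inf\big\{\|\varphi\|_{W^{s,p,\omega}(\mathbb R^n)}^p:\ \varphi\in W^{s,p,\omega}(\mathbb R^n),\ \varphi\ge 1\text{ in an open set containing }E\big\},$$ with $\inf\emptyset=\infty$. Theorem. Let $\omega$ be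 an $A_p$ weight in $\mathbb R^n$ such that $C_0^\infty(\mathbb R^n)\subset W^{s,p,\omega}(\mathbb R^n)$. Then, for every $f\in W^{s,p,\omega}(\mathbb R^n)$, there is a $G_\delta$-set $E\subset\mathbb R^n$ such that $C_{s,p,\omega}(E)=0$ and the (finite) limit $$\lim_{r\to0_+}\frac1{|B(x,r)|}\int_{B(x,r)}f(y)\,dy=:f^*(x)$$ exists for every $x\in\mathbb R^n\setminus E$. Moreover, for every $\varepsilon>0$ there is an open set $U\subset\mathbb R^n$ such that $C_{s,p,\omega}(U)<\varepsilon$, the limit defining $f^*(x)$ exists for every $x\in\mathbb R^n\setminus U$, and the restriction of $f^*$ to $\mathbb R^n\setminus U$ is continuous. -/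

import Mathlib

open MeasureTheory Set Filter Topology
open scoped ENNReal NNReal

namespace FracSobolev

noncomputable section

/-- The closed axis-parallel cube with lower corner `a` and side length `l`. -/
def cube {n : ℕ} (a : EuclideanSpace ℝ (Fin n)) (l : ℝ) : Set (EuclideanSpace ℝ (Fin n)) :=
  {x | ∀ i, x i ∈ Icc (a i) (a i + l)}

/-- A weight: a locally integrable function that is positive almost everywhere. -/
structure IsWeight {n : ℕ} (ω : EuclideanSpace ℝ (Fin n) → ℝ) : Prop where
  locallyIntegrable : LocallyIntegrable ω volume
  pos : ∀ᵐ x, 0 < ω x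

/-- A Muckenhoupt `A_p` weight. The averages are taken in `[0, ∞]`, so that the condition
includes the local integrability of `ω ^ (-1 / (p - 1))`. -/
structure IsApWeight {n : ℕ} (p : ℝ) (ω : EuclideanSpace ℝ (Fin n) → ℝ) : Prop
    extends IsWeight ω where
  bound : ∃ A : ℝ≥0, ∀ (a : EuclideanSpace ℝ (Fin n)) (l : ℝ), 0 < l →
    (⨍⁻ x in cube a l, ENNReal.ofReal (ω x) ∂volume) *
      (⨍⁻ x in cube a l, ENNReal.ofReal (ω x ^ (-1 / (p - 1))) ∂volume) ^ (p - 1) ≤ A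

/-- The `p`-th power of the fractional weighted Sobolev seminorm on `ℝⁿ`. -/
def seminormPow {n : ℕ} (s p : ℝ) (ω f : EuclideanSpace ℝ (Fin n) → ℝ) : ℝ≥0∞ :=
  ∫⁻ x, ∫⁻ y, ENNReal.ofReal (|f x - f y| ^ p / ‖x - y‖ ^ (s * p) * ω (x - y))

/-- The `p`-th power of the fractional weighted Sobolev norm on `ℝⁿ`. -/
def normPow {n : ℕ} (s p : ℝ) (ω f : EuclideanSpace ℝ (Fin n) → ℝ) : ℝ≥0∞ :=
  eLpNorm f (ENNReal.ofReal p) volume ^ p + seminormPow s p ω f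

/-- `f` is (a representative of) an element of the fractional weighted Sobolev space
`W^{s,p,ω}(ℝⁿ)`: it lies in `L^p` and its Sobolev norm is finite. -/
structure MemW {n : ℕ} (s p : ℝ) (ω f : EuclideanSpace ℝ (Fin n) → ℝ) : Prop where
  memLp : MemLp f (ENNReal.ofReal p) volume
  normPow_lt_top : normPow s p ω f < ∞

/-- The functions admissible for the Sobolev capacity of `E`: elements of `W^{s,p,ω}(ℝⁿ)`
that are at least `1` in an open set containing `E`. -/
def admissible {n : ℕ} (s p : ℝ) (ω : EuclideanSpace ℝ (Fin n) → ℝ)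
    (E : Set (EuclideanSpace ℝ (Fin n))) : Set (EuclideanSpace ℝ (Fin n) → ℝ) :=
  {φ | MemW s p ω φ ∧ ∃ V, IsOpen V ∧ E ⊆ V ∧ ∀ x ∈ V, 1 ≤ φ x}

/-- The `(s,p,ω)`-Sobolev capacity; it is `∞` if there is no admissible function. -/
def capacity {n : ℕ} (s p : ℝ) (ω : EuclideanSpace ℝ (Fin n) → ℝ)
    (E : Set (EuclideanSpace ℝ (Fin n))) : ℝ≥0∞ :=
  ⨅ φ ∈ admissible s p ω E, normPow s p ω φ

/-- The function `f^*`, the limit of the averages of `f` over the balls `B(x,r)` as `r → 0+`.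
It is meaningful only at the points where this limit exists. -/
def limitRep {n : ℕ} (f : EuclideanSpace ℝ (Fin n) → ℝ) (x : EuclideanSpace ℝ (Fin n)) : ℝ :=
  limUnder (𝓝[>] (0 : ℝ)) (fun r : ℝ => ⨍ y in Metric.ball x r, f y)

/-- The limit defining `f^*` exists at `x` (as a real number), and `f^* x` is this limit. -/
def HasLimitRepAt {n : ℕ} (f : EuclideanSpace ℝ (Fin n) → ℝ) (x : EuclideanSpace ℝ (Fin n)) :
    Prop :=
  Tendsto (fun r : ℝ => ⨍ y in Metric.ball x r, f y) (𝓝[>] (0 : ℝ)) (𝓝 (limitRep f x))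

end

end FracSobolev

/-! After the substitution `y = x - h` and Tonelli, the Sobolev norm becomes `energy`: the `L^p`
norm of `f` plus a weighted integral over `h` of the `L^p` norms of the differences `f - f(· - h)`.
Ball averaging and the maximal operator commute with translations, so an `L^p` fact applied to each
difference passes to the whole norm, whatever the weight.

Two consequences carry the proof. By dominated convergence, with the maximal function as majorant,
the ball averages of `f`, which are continuous, converge to `f` in energy
(`tendsto_energy_sub_setAverage_ball`); they serve as the continuous approximants. By sublinearity
of the maximal operator, a truncated supremum of maximal functions has energy at most a constant
times the sum of the energies (`energy_truncatedMaximal_le`). This yields a capacitary weak type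
inequality for a whole sequence at once (`capacity_lt_iSup_maximal_le`), so subadditivity of
capacity is not needed.

Choose averages `b i` approximating `f` very fast. Off an open set of small capacity, the maximal
function of `f - b i` is at most `2^{-i}` for all large `i`. There the averages of `f` are Cauchy as
the radius shrinks, and their limit is a uniform limit of the continuous `b i`. -/

namespace FracSobolev

set_option linter.unusedSectionVars false

/-! ### The Hardy–Littlewood maximal function: semicontinuity, weak type and strong type bounds. -/

section Maximal

open Metric Module

variable {E : Type*} [NormedAddCommGroup E] [NormedSpace ℝ E] [FiniteDimensional ℝ E]
  [MeasurableSpace E] [BorelSpace E] (μ : Measure E) [μ.IsAddHaarMeasure]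

/-- The centered Hardy–Littlewood maximal function. -/
noncomputable def maximal (g : E → ℝ≥0∞) (x : E) : ℝ≥0∞ :=
  ⨆ (r : ℝ) (_ : 0 < r), ⨍⁻ y in ball x r, g y ∂μ

variable {μ}

theorem ball_ae_eq_closedBall (x : E) {r : ℝ} (hr : 0 < r) : ball x r =ᵐ[μ] closedBall x r := by
  refine ball_subset_closedBall.eventuallyLE.antisymm (ae_le_set.2 ?_)
  rw [closedBall_sdiff_ball, Measure.addHaar_sphere_of_ne_zero μ x hr.ne']

theorem maximal_mono {g h : E → ℝ≥0∞} (hgh : g ≤ h) (x : E) : maximal μ g x ≤ maximal μ h x :=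
  iSup₂_mono fun _ _ => laverage_mono_ae (Eventually.of_forall hgh)

theorem setLAverage_ball_le_maximal (g : E → ℝ≥0∞) (x : E) {r : ℝ} (hr : 0 < r) :
    ⨍⁻ y in ball x r, g y ∂μ ≤ maximal μ g x :=
  le_iSup₂ (f := fun (r : ℝ) (_ : 0 < r) => ⨍⁻ y in ball x r, g y ∂μ) r hr

theorem maximal_add_le {g : E → ℝ≥0∞} (hg : Measurable g) (h : E → ℝ≥0∞) (x : E) :
    maximal μ (fun y => g y + h y) x ≤ maximal μ g x + maximal μ h x := by
  refine iSup₂_le fun r hr => ?_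
  rw [laverage_eq, lintegral_add_left hg, ENNReal.add_div, ← laverage_eq, ← laverage_eq]
  exact add_le_add (setLAverage_ball_le_maximal g x hr) (setLAverage_ball_le_maximal h x hr)

theorem maximal_const (c : ℝ≥0∞) (x : E) : maximal μ (fun _ => c) x ≤ c := by
  refine iSup₂_le fun r hr => ?_
  rw [setLAverage_const (measure_ball_pos μ x hr).ne' measure_ball_lt_top.ne]

theorem setLIntegral_ball_comp_sub (g : E → ℝ≥0∞) (x h : E) (r : ℝ) :
    ∫⁻ y in ball x r, g (y - h) ∂μ = ∫⁻ y in ball (x - h) r, g y ∂μ := by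
  have hpre : (fun y => y - h) ⁻¹' ball (x - h) r = ball x r := by
    ext y; simp [dist_eq_norm]
  rw [← hpre]
  exact (measurePreserving_sub_right μ h).setLIntegral_comp_preimage_emb
    (MeasurableEquiv.subRight h).measurableEmbedding g _

theorem maximal_comp_sub (g : E → ℝ≥0∞) (x h : E) :
    maximal μ (fun y => g (y - h)) x = maximal μ g (x - h) := by
  unfold maximal
  refine iSup_congr fun r => iSup_congr fun hr => ?_
  rw [setLAverage_eq, setLAverage_eq, setLIntegral_ball_comp_sub,
    Measure.addHaar_ball_center, Measure.addHaar_ball_center μ (x - h)]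

/-- The open ball is an increasing union of smaller concentric balls, and each of these lies in the
ball of radius `r` about any nearby centre. -/
theorem lowerSemicontinuous_setLIntegral_ball (g : E → ℝ≥0∞) (r : ℝ) :
    LowerSemicontinuous fun x => ∫⁻ y in ball x r, g y ∂μ := by
  intro x a ha
  have hU : ball x r = ⋃ k : ℕ, ball x (r - 1 / ((k : ℝ) + 1)) := by
    ext y
    simp only [mem_iUnion, mem_ball]
    refine ⟨fun hy => ?_, fun ⟨k, hk⟩ => hk.trans (by
      have : (0 : ℝ) < 1 / ((k : ℝ) + 1) := by positivity
      linarith)⟩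
    obtain ⟨k, hk⟩ := exists_nat_one_div_lt (sub_pos.2 hy)
    exact ⟨k, by linarith⟩
  have hmono : Monotone fun k : ℕ => ball x (r - 1 / ((k : ℝ) + 1)) := fun i j hij =>
    ball_subset_ball (by
      have := Nat.one_div_le_one_div (α := ℝ) hij
      linarith)
  have hsup : ∫⁻ y in ball x r, g y ∂μ
      = ⨆ k : ℕ, ∫⁻ y in ball x (r - 1 / ((k : ℝ) + 1)), g y ∂μ := by
    conv_lhs => rw [hU]
    exact setLIntegral_iUnion_of_directed g hmono.directed_le
  simp only at ha
  rw [hsup, gt_iff_lt, lt_iSup_iff] at ha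
  obtain ⟨k, hk⟩ := ha
  filter_upwards [ball_mem_nhds x (show (0 : ℝ) < 1 / ((k : ℝ) + 1) by positivity)] with z hz
  refine hk.trans_le (lintegral_mono_set fun y hy => ?_)
  rw [mem_ball] at *
  have := dist_triangle_right y z x
  linarith [dist_triangle y x z, dist_comm x z]

theorem lowerSemicontinuous_maximal (g : E → ℝ≥0∞) : LowerSemicontinuous (maximal μ g) := by
  refine lowerSemicontinuous_biSup fun r hr x a ha => ?_
  have hV0 := (measure_ball_pos μ (0 : E) hr).ne'
  have hV1 : μ (ball (0 : E) r) ≠ ∞ := measure_ball_lt_top.ne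
  simp only [setLAverage_eq, Measure.addHaar_ball_center μ _ r] at ha ⊢
  rw [gt_iff_lt, ENNReal.lt_div_iff_mul_lt (Or.inl hV0) (Or.inl hV1)] at ha
  filter_upwards [lowerSemicontinuous_setLIntegral_ball g r x _ ha] with z hz
  rwa [gt_iff_lt, ENNReal.lt_div_iff_mul_lt (Or.inl hV0) (Or.inl hV1)]

theorem measurable_maximal (g : E → ℝ≥0∞) : Measurable (maximal μ g) :=
  (lowerSemicontinuous_maximal g).measurable

/-- The weak type `(1,1)` inequality. -/
theorem measure_lt_maximal_le (g : E → ℝ≥0∞) (a : ℝ≥0∞) :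
    a * μ {x | a < maximal μ g x} ≤ ENNReal.ofReal (5 ^ finrank ℝ E) * ∫⁻ y, g y ∂μ := by
  -- The Vitali covering lemma needs bounded radii, so the superlevel set is exhausted by points
  -- whose witnessing radius is at most `k`.
  set A : ℕ → Set E := fun k => {x | ∃ r : ℝ, 0 < r ∧ r ≤ k ∧ a < ⨍⁻ y in ball x r, g y ∂μ}
  have hA : {x | a < maximal μ g x} = ⋃ k, A k := by
    ext x
    simp only [maximal, lt_iSup_iff, mem_ofPred_eq, mem_iUnion, A]
    constructor
    · rintro ⟨r, hr, h⟩
      obtain ⟨k, hk⟩ := exists_nat_ge r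
      exact ⟨k, r, hr, hk, h⟩
    · rintro ⟨k, r, hr, -, h⟩
      exact ⟨r, hr, h⟩
  have hmono : Monotone A := fun i j hij x ⟨r, hr, hri, h⟩ =>
    ⟨r, hr, hri.trans (by exact_mod_cast hij), h⟩
  rw [hA, hmono.measure_iUnion, ENNReal.mul_iSup]
  refine iSup_le fun k => ?_
  choose! ρ hρ0 hρk hρ using (show ∀ x ∈ A k, ∃ r : ℝ, 0 < r ∧ r ≤ k ∧
    a < ⨍⁻ y in ball x r, g y ∂μ from fun x hx => hx)
  obtain ⟨u, hu, hdisj, hcov⟩ := Vitali.exists_disjoint_subfamily_covering_enlargement_closedBall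
    (A k) id ρ k hρk 5 (by norm_num)
  have hdisj' : u.PairwiseDisjoint fun x => ball x (ρ x) :=
    hdisj.mono fun x => ball_subset_closedBall
  have hcount : u.Countable := hdisj'.countable_of_isOpen (fun _ _ => isOpen_ball)
    fun x hx => nonempty_ball.2 (hρ0 x (hu hx))
  have hsub : A k ⊆ ⋃ b ∈ u, closedBall b (5 * ρ b) := fun x hx => by
    obtain ⟨b, hb, h⟩ := hcov x hx
    exact mem_biUnion hb (h (mem_closedBall_self (hρ0 x hx).le))
  calc a * μ (A k) ≤ a * ∑' b : u, μ (closedBall (b : E) (5 * ρ b)) := by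
        gcongr
        exact (measure_mono hsub).trans (measure_biUnion_le μ hcount _)
    _ = ∑' b : u, a * μ (closedBall (b : E) (5 * ρ b)) := ENNReal.tsum_mul_left.symm
    _ ≤ ∑' b : u, ENNReal.ofReal (5 ^ finrank ℝ E) * ∫⁻ y in ball (b : E) (ρ b), g y ∂μ := by
        refine ENNReal.tsum_le_tsum fun b => ?_
        have hb0 := hρ0 b (hu b.2)
        have h5 : μ (closedBall (b : E) (5 * ρ b))
            = ENNReal.ofReal (5 ^ finrank ℝ E) * μ (ball (b : E) (ρ b)) := by
          rw [Measure.addHaar_closedBall_mul_of_pos μ _ (by norm_num),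
            measure_congr (ball_ae_eq_closedBall (μ := μ) (b : E) hb0),
            Measure.addHaar_closedBall_center μ (b : E)]
        rw [h5, mul_left_comm]
        gcongr
        have := (hρ b (hu b.2)).le
        rw [setLAverage_eq, ENNReal.le_div_iff_mul_le
          (Or.inl (measure_ball_pos μ _ hb0).ne') (Or.inl measure_ball_lt_top.ne)] at this
        exact this
    _ = ENNReal.ofReal (5 ^ finrank ℝ E) * ∫⁻ y in ⋃ b ∈ u, ball b (ρ b), g y ∂μ := by
        rw [ENNReal.tsum_mul_left, lintegral_biUnion hcount (fun _ _ => measurableSet_ball) hdisj']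
    _ ≤ ENNReal.ofReal (5 ^ finrank ℝ E) * ∫⁻ y, g y ∂μ := by
        gcongr
        exact Measure.restrict_le_self

/-- The layer cake formula for a single value, obtained from a Dirac mass; the value `∞` follows by
monotonicity. -/
theorem lintegral_Ioi_indicator_rpow (a : ℝ≥0∞) {q : ℝ} (hq : 0 < q) :
    ENNReal.ofReal q * ∫⁻ t in Ioi (0 : ℝ),
      {t | ENNReal.ofReal t < a}.indicator (fun t => ENNReal.ofReal (t ^ (q - 1))) t = a ^ q := by
  have key : ∀ b : ℝ, 0 ≤ b → ENNReal.ofReal q * ∫⁻ t in Ioi (0 : ℝ),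
      {t | ENNReal.ofReal t < ENNReal.ofReal b}.indicator
        (fun t => ENNReal.ofReal (t ^ (q - 1))) t = ENNReal.ofReal b ^ q := by
    intro b hb
    have h := lintegral_rpow_eq_lintegral_meas_lt_mul (Measure.dirac ()) (f := fun _ => b)
      (Eventually.of_forall fun _ => hb) aemeasurable_const hq
    rw [lintegral_dirac, ← ENNReal.ofReal_rpow_of_nonneg hb hq.le] at h
    rw [h]
    congr 1
    refine setLIntegral_congr_fun measurableSet_Ioi fun t ht => ?_
    rw [mem_Ioi] at ht
    by_cases htb : t < b
    · have hb' : 0 < b := ht.trans htb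
      simp [indicator, htb, hb', ENNReal.ofReal_lt_ofReal_iff]
    · simp [indicator, htb, ENNReal.ofReal_lt_ofReal_iff', -not_lt]
  rcases eq_or_ne a ∞ with rfl | ha
  · rw [ENNReal.top_rpow_of_pos hq, eq_top_iff]
    refine ENNReal.le_of_forall_nnreal_lt fun c _ => ?_
    have hc : (c : ℝ≥0∞) = ENNReal.ofReal ((c : ℝ) ^ q⁻¹) ^ q := by
      rw [ENNReal.ofReal_rpow_of_nonneg (by positivity) hq.le, ← Real.rpow_mul c.coe_nonneg,
        inv_mul_cancel₀ hq.ne', Real.rpow_one, ENNReal.ofReal_coe_nnreal]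
    rw [hc, ← key _ (by positivity)]
    gcongr ENNReal.ofReal q * ∫⁻ t in _, ?_ with t
    exact indicator_le_indicator_of_subset (fun t _ => ENNReal.ofReal_lt_top)
      (fun _ => zero_le) _
  · rw [← ENNReal.ofReal_toReal ha]
    exact key _ ENNReal.toReal_nonneg

/-- The weak type inequality for the part of `g` above half the height. -/
theorem measure_lt_maximal_le_truncated {g : E → ℝ≥0∞} (hg : Measurable g) (a : ℝ≥0∞) :
    a * μ {x | a < maximal μ g x} ≤
      2 * ENNReal.ofReal (5 ^ finrank ℝ E) * ∫⁻ y, {y | a < 2 * g y}.indicator g y ∂μ := by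
  -- Where `2 * g ≤ a` the function is at most `a / 2`, so this part adds at most `a / 2` to the
  -- maximal function.
  have hle : g ≤ fun y => {y | a < 2 * g y}.indicator g y + a / 2 := by
    intro y
    by_cases hy : a < 2 * g y
    · simp [indicator, hy]
    · simp only [indicator, mem_ofPred_eq, hy, if_false, zero_add]
      rw [ENNReal.le_div_iff_mul_le (by simp) (by simp), mul_comm]
      exact not_lt.1 hy
  have hmeas : Measurable ({y | a < 2 * g y}.indicator g) :=
    hg.indicator (measurableSet_lt measurable_const (hg.const_mul 2))
  have hsub : {x | a < maximal μ g x} ⊆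
      {x | a / 2 < maximal μ ({y | a < 2 * g y}.indicator g) x} := by
    intro x (hx : a < _)
    by_contra hcon
    have h1 := (maximal_mono hle x).trans (maximal_add_le (μ := μ) hmeas _ x)
    have h2 := h1.trans (add_le_add (not_lt.1 hcon) (maximal_const (μ := μ) (a / 2) x))
    rw [ENNReal.add_halves] at h2
    exact absurd hx (not_lt.2 h2)
  calc a * μ {x | a < maximal μ g x}
      ≤ (2 * (a / 2)) * μ {x | a / 2 < maximal μ ({y | a < 2 * g y}.indicator g) x} := by
        rw [ENNReal.mul_div_cancel (by simp) (by simp)]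
        gcongr
    _ ≤ _ := by
        rw [mul_assoc, mul_assoc]
        gcongr (2 : ℝ≥0∞) * ?_
        exact measure_lt_maximal_le (μ := μ) _ _

/-- The Hardy–Littlewood maximal inequality. -/
theorem lintegral_maximal_rpow_le {g : E → ℝ≥0∞} (hg : Measurable g) {p : ℝ} (hp : 1 < p) :
    ∫⁻ x, maximal μ g x ^ p ∂μ ≤
      ENNReal.ofReal (2 ^ p * 5 ^ finrank ℝ E * p / (p - 1)) * ∫⁻ x, g x ^ p ∂μ := by
  have hp0 : 0 < p := by linarith
  have hp1 : 0 < p - 1 := by linarith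
  set K := ENNReal.ofReal (5 ^ finrank ℝ E)
  calc ∫⁻ x, maximal μ g x ^ p ∂μ
      = ∫⁻ x, ENNReal.ofReal p * (∫⁻ t in Ioi (0 : ℝ),
          {t | ENNReal.ofReal t < maximal μ g x}.indicator
            (fun t => ENNReal.ofReal (t ^ (p - 1))) t) ∂μ := by
        simp_rw [lintegral_Ioi_indicator_rpow _ hp0]
    _ = ENNReal.ofReal p * ∫⁻ t in Ioi (0 : ℝ), ∫⁻ x,
          {t | ENNReal.ofReal t < maximal μ g x}.indicator
            (fun t => ENNReal.ofReal (t ^ (p - 1))) t ∂μ := by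
        rw [lintegral_const_mul' _ _ ENNReal.ofReal_ne_top, lintegral_lintegral_swap]
        refine Measurable.aemeasurable ?_
        have h := measurable_maximal (μ := μ) g
        exact Measurable.ite (p := fun z : E × ℝ => ENNReal.ofReal z.2 < maximal μ g z.1)
          (measurableSet_lt (by fun_prop) (by fun_prop)) (by fun_prop) measurable_const
    -- The weak type bound costs one power of `t`; the remaining `t ^ (p - 2)` is integrable near
    -- `0` because `p > 1`.
    _ ≤ ENNReal.ofReal p * ∫⁻ t in Ioi (0 : ℝ), 2 * K * ∫⁻ x, g x *
          {t | ENNReal.ofReal t < 2 * g x}.indicator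
            (fun t => ENNReal.ofReal (t ^ (p - 1 - 1))) t ∂μ := by
        gcongr ENNReal.ofReal p * ?_
        refine setLIntegral_mono' measurableSet_Ioi fun t ht => ?_
        rw [mem_Ioi] at ht
        have ht' : ENNReal.ofReal (t ^ (p - 1)) =
            ENNReal.ofReal (t ^ (p - 1 - 1)) * ENNReal.ofReal t := by
          rw [← ENNReal.ofReal_mul (by positivity), Real.rpow_sub_one ht.ne' (p - 1),
            div_mul_cancel₀ _ ht.ne']
        have e1 : ∫⁻ x, {t | ENNReal.ofReal t < maximal μ g x}.indicator
            (fun t => ENNReal.ofReal (t ^ (p - 1))) t ∂μ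
            = ENNReal.ofReal (t ^ (p - 1)) * μ {x | ENNReal.ofReal t < maximal μ g x} := by
          rw [← lintegral_indicator_const
            (measurableSet_lt measurable_const (measurable_maximal g))]
          rfl
        have e2 : ∫⁻ x, g x * {t | ENNReal.ofReal t < 2 * g x}.indicator
            (fun t => ENNReal.ofReal (t ^ (p - 1 - 1))) t ∂μ
            = ENNReal.ofReal (t ^ (p - 1 - 1)) *
              ∫⁻ x, {x | ENNReal.ofReal t < 2 * g x}.indicator g x ∂μ := by
          rw [← lintegral_const_mul' _ _ ENNReal.ofReal_ne_top]
          refine lintegral_congr fun x => ?_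
          simp only [indicator, mem_ofPred_eq]
          split_ifs
          · rw [mul_comm]
          · simp
        rw [e1, e2, ht', mul_left_comm, mul_assoc]
        gcongr ENNReal.ofReal (t ^ (p - 1 - 1)) * ?_
        exact measure_lt_maximal_le_truncated hg _
    _ = ENNReal.ofReal p * (2 * K * ∫⁻ x, g x * (∫⁻ t in Ioi (0 : ℝ),
          {t | ENNReal.ofReal t < 2 * g x}.indicator
            (fun t => ENNReal.ofReal (t ^ (p - 1 - 1))) t) ∂μ) := by
        have hm : Measurable fun z : E × ℝ => {t | ENNReal.ofReal t < 2 * g z.1}.indicator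
            (fun t => ENNReal.ofReal (t ^ (p - 1 - 1))) z.2 :=
          Measurable.ite (p := fun z : E × ℝ => ENNReal.ofReal z.2 < 2 * g z.1)
            (measurableSet_lt (by fun_prop) (by fun_prop)) (by fun_prop) measurable_const
        rw [lintegral_const_mul' _ _ (by finiteness), ← lintegral_lintegral_swap]
        · congr! 4 with x
          rw [lintegral_const_mul]
          exact hm.comp measurable_prodMk_left
        · exact ((hg.comp measurable_fst).mul hm).aemeasurable
    _ = ENNReal.ofReal p * (2 * K * ∫⁻ x, ENNReal.ofReal (2 ^ (p - 1) / (p - 1)) * g x ^ p ∂μ) := by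
        congr! 4 with x
        have h := lintegral_Ioi_indicator_rpow (2 * g x) hp1
        have h0 : ENNReal.ofReal (p - 1) ≠ 0 := by simpa using hp1
        rw [← ENNReal.eq_div_iff h0 ENNReal.ofReal_ne_top] at h
        have h1 : g x ^ p = g x * g x ^ (p - 1) := by
          conv_rhs => rw [← ENNReal.rpow_one (g x), ← ENNReal.rpow_mul, one_mul,
            ← ENNReal.rpow_add_of_nonneg _ _ zero_le_one hp1.le]
          congr 1; ring
        rw [h, ENNReal.mul_rpow_of_nonneg _ _ hp1.le, h1, ENNReal.ofReal_div_of_pos hp1,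
          ← ENNReal.ofReal_rpow_of_pos two_pos, ENNReal.ofReal_ofNat, div_eq_mul_inv,
          div_eq_mul_inv]
        ring
    _ = _ := by
        rw [lintegral_const_mul' _ _ ENNReal.ofReal_ne_top, ← mul_assoc, ← mul_assoc, ← mul_assoc]
        congr 1
        rw [← ENNReal.ofReal_ofNat 2, ← ENNReal.ofReal_mul (by positivity),
          ← ENNReal.ofReal_mul (by positivity), ← ENNReal.ofReal_mul (by positivity)]
        congr 1
        rw [Real.rpow_sub_one (by norm_num)]
        field_simp

end Maximal

/-! ### Ball averages as continuous approximants, and the energy. -/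

section BallAverages

open Metric Module

variable {E : Type*} [NormedAddCommGroup E] [NormedSpace ℝ E] [FiniteDimensional ℝ E]
  [MeasurableSpace E] [BorelSpace E] {μ : Measure E} [μ.IsAddHaarMeasure]

theorem integrableOn_ball {f : E → ℝ} (hf : LocallyIntegrable f μ) (x : E) (r : ℝ) :
    IntegrableOn f (ball x r) μ :=
  (hf.integrableOn_isCompact (isCompact_closedBall x r)).mono_set ball_subset_closedBall

theorem setAverage_ball_eq (f : E → ℝ) (x : E) (r : ℝ) :
    ⨍ y in ball x r, f y ∂μ = (μ.real (ball (0 : E) r))⁻¹ * ∫ y in ball x r, f y ∂μ := by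
  rw [setAverage_eq, smul_eq_mul, measureReal_def, Measure.addHaar_ball_center, measureReal_def]

theorem setAverage_ball_sub {f g : E → ℝ} (hf : LocallyIntegrable f μ)
    (hg : LocallyIntegrable g μ) (x : E) (r : ℝ) :
    ⨍ y in ball x r, (f y - g y) ∂μ = ⨍ y in ball x r, f y ∂μ - ⨍ y in ball x r, g y ∂μ := by
  simp_rw [setAverage_ball_eq]
  rw [integral_sub (integrableOn_ball hf x r) (integrableOn_ball hg x r), mul_sub]

theorem setAverage_ball_comp_sub (f : E → ℝ) (x h : E) (r : ℝ) :
    ⨍ y in ball x r, f (y - h) ∂μ = ⨍ y in ball (x - h) r, f y ∂μ := by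
  have hpre : (fun y => y - h) ⁻¹' ball (x - h) r = ball x r := by
    ext y; simp [dist_eq_norm]
  simp_rw [setAverage_ball_eq]
  rw [← hpre, (measurePreserving_sub_right μ h).setIntegral_preimage_emb
    (MeasurableEquiv.subRight h).measurableEmbedding f _]

theorem enorm_setAverage_ball_le (f : E → ℝ) (x : E) {r : ℝ} (hr : 0 < r) :
    ‖⨍ y in ball x r, f y ∂μ‖ₑ ≤ maximal μ (fun y => ‖f y‖ₑ) x :=
  (enorm_integral_le_lintegral_enorm _).trans
    (setLAverage_ball_le_maximal (fun y => ‖f y‖ₑ) x hr)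

/-- Dominated convergence: as the centre moves, the indicators of the balls converge off the
limiting sphere, which is null. -/
theorem continuous_setAverage_ball {f : E → ℝ} (hf : LocallyIntegrable f μ) {r : ℝ} (hr : 0 < r) :
    Continuous fun x => ⨍ y in ball x r, f y ∂μ := by
  simp_rw [setAverage_ball_eq]
  refine continuous_const.mul (continuous_iff_continuousAt.2 fun x₀ => ?_)
  simp_rw [← integral_indicator measurableSet_ball]
  refine continuousAt_of_dominated (bound := (ball x₀ (r + 1)).indicator fun y => ‖f y‖)
    (Eventually.of_forall fun x => hf.aestronglyMeasurable.indicator measurableSet_ball) ?_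
    ((integrable_indicator_iff measurableSet_ball).2 (integrableOn_ball hf x₀ _).norm) ?_
  · filter_upwards [ball_mem_nhds x₀ one_pos] with x hx
    refine Eventually.of_forall fun y => ?_
    rw [norm_indicator_eq_indicator_norm]
    refine indicator_le_indicator_of_subset (fun z hz => ?_) (fun _ => norm_nonneg _) y
    rw [mem_ball] at *
    linarith [dist_triangle z x x₀]
  · have hs : ∀ᵐ y ∂μ, y ∉ sphere x₀ r :=
      measure_eq_zero_iff_ae_notMem.1 (Measure.addHaar_sphere_of_ne_zero μ x₀ hr.ne')
    filter_upwards [hs] with y hy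
    rw [mem_sphere] at hy
    have hc : ContinuousAt (fun x => dist y x) x₀ := by fun_prop
    rcases lt_or_gt_of_ne hy with h | h
    · refine (continuousAt_const (y := f y)).congr ?_
      filter_upwards [hc.eventually_lt continuousAt_const h] with x hx
      rw [indicator_of_mem (mem_ball.2 hx)]
    · refine (continuousAt_const (y := (0 : ℝ))).congr ?_
      filter_upwards [continuousAt_const.eventually_lt hc h] with x hx
      rw [indicator_of_notMem fun hm => (mem_ball.1 hm).not_gt hx]

theorem ae_tendsto_setAverage_ball {f : E → ℝ} (hf : LocallyIntegrable f μ) {r : ℕ → ℝ}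
    (hr0 : ∀ k, 0 < r k) (hr : Tendsto r atTop (𝓝 0)) :
    ∀ᵐ x ∂μ, Tendsto (fun k => ⨍ y in ball x (r k), f y ∂μ) atTop (𝓝 (f x)) := by
  filter_upwards [IsUnifLocDoublingMeasure.ae_tendsto_average μ hf 1] with x hx
  have h := hx (fun _ => x) r
    (tendsto_nhdsWithin_iff.2 ⟨hr, Eventually.of_forall hr0⟩)
    (Eventually.of_forall fun k => mem_closedBall_self (by linarith [hr0 k]))
  refine h.congr fun k => ?_
  rw [setAverage_congr (ball_ae_eq_closedBall x (hr0 k))]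

theorem lintegral_enorm_rpow_lt_top {f : E → ℝ} {p : ℝ} (hp : 0 < p)
    (hf : MemLp f (ENNReal.ofReal p) μ) : ∫⁻ x, ‖f x‖ₑ ^ p ∂μ < ∞ := by
  have := lintegral_rpow_enorm_lt_top_of_eLpNorm_lt_top (by simpa using hp)
    ENNReal.ofReal_ne_top hf.2
  rwa [ENNReal.toReal_ofReal hp.le] at this

theorem locallyIntegrable_of_memLp {f : E → ℝ} {p : ℝ} (hp : 1 < p)
    (hf : MemLp f (ENNReal.ofReal p) μ) : LocallyIntegrable f μ :=
  hf.locallyIntegrable (by simpa using hp.le)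

variable (E) in
/-- The constant in the Hardy–Littlewood maximal inequality. -/
noncomputable def maximalConst (p : ℝ) : ℝ≥0∞ :=
  ENNReal.ofReal (2 ^ p * 5 ^ finrank ℝ E * p / (p - 1))

theorem lintegral_enorm_add_maximal_rpow_le {f : E → ℝ} (hf : Measurable f) {p : ℝ} (hp : 1 < p) :
    ∫⁻ x, (‖f x‖ₑ + maximal μ (fun y => ‖f y‖ₑ) x) ^ p ∂μ ≤
      2 ^ (p - 1) * (1 + maximalConst E p) * ∫⁻ x, ‖f x‖ₑ ^ p ∂μ := by
  calc _ ≤ ∫⁻ x, 2 ^ (p - 1) * (‖f x‖ₑ ^ p + maximal μ (fun y => ‖f y‖ₑ) x ^ p) ∂μ :=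
        lintegral_mono fun x => ENNReal.rpow_add_le_mul_rpow_add_rpow _ _ hp.le
    _ = 2 ^ (p - 1) * (∫⁻ x, ‖f x‖ₑ ^ p ∂μ + ∫⁻ x, maximal μ (fun y => ‖f y‖ₑ) x ^ p ∂μ) := by
        rw [lintegral_const_mul' _ _ (by finiteness), lintegral_add_left (by fun_prop)]
    _ ≤ _ := by
        rw [mul_assoc, add_mul, one_mul]
        gcongr
        exact lintegral_maximal_rpow_le hf.enorm hp

theorem enorm_sub_setAverage_ball_le (f : E → ℝ) (x : E) {r : ℝ} (hr : 0 < r) :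
    ‖f x - ⨍ y in ball x r, f y ∂μ‖ₑ ≤ ‖f x‖ₑ + maximal μ (fun y => ‖f y‖ₑ) x :=
  enorm_sub_le.trans (add_le_add le_rfl (enorm_setAverage_ball_le f x hr))

/-- Lebesgue differentiation gives the pointwise limit, and `|f| + Mf`, in `L^p` by the maximal
inequality, dominates. -/
theorem tendsto_lintegral_sub_setAverage_ball {f : E → ℝ} (hf : Measurable f) {p : ℝ} (hp : 1 < p)
    (hfp : MemLp f (ENNReal.ofReal p) μ) {r : ℕ → ℝ}
    (hr0 : ∀ k, 0 < r k) (hr : Tendsto r atTop (𝓝 0)) :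
    Tendsto (fun k => ∫⁻ x, ‖f x - ⨍ y in ball x (r k), f y ∂μ‖ₑ ^ p ∂μ) atTop (𝓝 0) := by
  have hp0 : 0 < p := by linarith
  have hloc := locallyIntegrable_of_memLp hp hfp
  rw [← lintegral_zero (μ := μ) (α := E)]
  refine tendsto_lintegral_of_dominated_convergence
    (fun x => (‖f x‖ₑ + maximal μ (fun y => ‖f y‖ₑ) x) ^ p) (fun k => ?_) (fun k => ?_) ?_ ?_
  · exact ((hf.sub (continuous_setAverage_ball hloc (hr0 k)).measurable).enorm).pow_const p
  · exact Eventually.of_forall fun x => ENNReal.rpow_le_rpow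
      (enorm_sub_setAverage_ball_le f x (hr0 k)) hp0.le
  · refine ((lintegral_enorm_add_maximal_rpow_le hf hp).trans_lt ?_).ne
    have := lintegral_enorm_rpow_lt_top hp0 hfp
    rw [maximalConst]
    finiteness
  · filter_upwards [ae_tendsto_setAverage_ball hloc hr0 hr] with x hx
    have h := (ENNReal.continuous_rpow_const (y := p)).tendsto _ |>.comp
      ((continuous_enorm.tendsto _).comp (tendsto_const_nhds (x := f x) |>.sub hx))
    simpa [hp0, Function.comp_def] using h

/-- The `p`-th power of a fractional Sobolev norm, in terms of the translation differences. -/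
noncomputable def energy (μ : Measure E) (p : ℝ) (w : E → ℝ≥0∞) (f : E → ℝ) : ℝ≥0∞ :=
  ∫⁻ x, ‖f x‖ₑ ^ p ∂μ + ∫⁻ h, w h * ∫⁻ x, ‖f x - f (x - h)‖ₑ ^ p ∂μ ∂μ

theorem memLp_sub_translate {f : E → ℝ} {p : ℝ≥0∞} (hf : MemLp f p μ) (h : E) :
    MemLp (fun x => f x - f (x - h)) p μ :=
  hf.sub (hf.comp_measurePreserving (measurePreserving_sub_right μ h))

theorem measurable_lintegral_sub_translate {f : E → ℝ} (hf : Measurable f) (p : ℝ) :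
    Measurable fun h => ∫⁻ x, ‖f x - f (x - h)‖ₑ ^ p ∂μ :=
  Measurable.lintegral_prod_right' (f := fun z : E × E => ‖f z.2 - f (z.2 - z.1)‖ₑ ^ p)
    (by fun_prop)

/-- For fixed `h` the `L^p` convergence applies to the difference `f - f(· - h)`; the maximal
inequality gives a majorant in `h`, a constant multiple of the integrand of the energy of `f`. -/
theorem tendsto_energy_sub_setAverage_ball {f : E → ℝ} (hf : Measurable f) {p : ℝ} (hp : 1 < p)
    (hfp : MemLp f (ENNReal.ofReal p) μ) {w : E → ℝ≥0∞} (hw : Measurable w) (hw' : ∀ h, w h ≠ ∞)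
    (hE : energy μ p w f < ∞) {r : ℕ → ℝ}
    (hr0 : ∀ k, 0 < r k) (hr : Tendsto r atTop (𝓝 0)) :
    Tendsto (fun k => energy μ p w fun x => f x - ⨍ y in ball x (r k), f y ∂μ) atTop (𝓝 0) := by
  have hp0 : 0 < p := by linarith
  have hloc := locallyIntegrable_of_memLp hp hfp
  have hD : ∀ h, Measurable fun x => f x - f (x - h) := fun h => by fun_prop
  -- Averaging commutes with translation, so the difference of the error is the error of the
  -- difference.
  have hcomm : ∀ (r : ℝ) (x h : E), (f x - ⨍ y in ball x r, f y ∂μ) -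
      (f (x - h) - ⨍ y in ball (x - h) r, f y ∂μ)
      = (f x - f (x - h)) - ⨍ y in ball x r, (f y - f (y - h)) ∂μ := by
    intro r x h
    have hloc' : LocallyIntegrable (fun y => f (y - h)) μ := locallyIntegrable_of_memLp hp
      (hfp.comp_measurePreserving (measurePreserving_sub_right μ h))
    rw [← setAverage_ball_comp_sub, setAverage_ball_sub hloc hloc']
    ring
  rw [← add_zero (0 : ℝ≥0∞)]
  refine (tendsto_lintegral_sub_setAverage_ball hf hp hfp hr0 hr).add ?_
  rw [← lintegral_zero (μ := μ) (α := E)]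
  refine tendsto_lintegral_of_dominated_convergence
    (fun h => 2 ^ (p - 1) * (1 + maximalConst E p) * (w h * ∫⁻ x, ‖f x - f (x - h)‖ₑ ^ p ∂μ))
    (fun k => ?_) (fun k => Eventually.of_forall fun h => ?_) ?_ ?_
  · exact hw.mul (measurable_lintegral_sub_translate
      (hf.sub (continuous_setAverage_ball hloc (hr0 k)).measurable) p)
  · beta_reduce
    rw [mul_left_comm]
    gcongr w h * ?_
    simp_rw [hcomm]
    exact (lintegral_mono fun x => ENNReal.rpow_le_rpow
      (enorm_sub_setAverage_ball_le (fun x => f x - f (x - h)) x (hr0 k)) hp0.le).trans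
      (lintegral_enorm_add_maximal_rpow_le (hD h) hp)
  · rw [lintegral_const_mul' _ _ (by rw [maximalConst]; finiteness)]
    have := (le_add_self.trans_lt hE : ∫⁻ h, w h * ∫⁻ x, ‖f x - f (x - h)‖ₑ ^ p ∂μ ∂μ < ∞)
    exact ENNReal.mul_ne_top (by rw [maximalConst]; finiteness) this.ne
  · refine Eventually.of_forall fun h => ?_
    simp_rw [hcomm]
    simpa using ENNReal.Tendsto.const_mul (tendsto_lintegral_sub_setAverage_ball (hD h) hp
      (memLp_sub_translate hfp h) hr0 hr) (Or.inr (hw' h))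

/-- Truncation at `1` is 1-Lipschitz. The two one-sided bounds express closeness even when `a` and
`b` are infinite. -/
theorem enorm_toReal_min_one_sub_le {a b d : ℝ≥0∞} (hab : a ≤ b + d) (hba : b ≤ a + d) :
    ‖(min 1 a).toReal - (min 1 b).toReal‖ₑ ≤ d := by
  rcases eq_or_ne d ∞ with rfl | hd
  · exact le_top
  have h1 : ∀ {a b : ℝ≥0∞}, a ≤ b + d → min 1 a ≤ min 1 b + d := fun {a b} h => by
    rcases le_total 1 b with hb | hb
    · rw [min_eq_left hb]; exact (min_le_left _ _).trans le_self_add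
    · rw [min_eq_right hb]; exact (min_le_right _ _).trans h
  have hfin : ∀ a : ℝ≥0∞, min 1 a ≠ ∞ := fun a => (min_le_left 1 a).trans_lt (by simp) |>.ne
  have h2 : ∀ {a b : ℝ≥0∞}, a ≤ b + d → (min 1 a).toReal - (min 1 b).toReal ≤ d.toReal :=
    fun {a b} h => by
      rw [sub_le_iff_le_add', ← ENNReal.toReal_add (hfin b) hd]
      exact ENNReal.toReal_mono (ENNReal.add_ne_top.2 ⟨hfin b, hd⟩) (h1 h)
  rw [Real.enorm_eq_ofReal_abs, ENNReal.ofReal_le_iff_le_toReal hd]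
  exact abs_sub_le_iff.2 ⟨h2 hab, h2 hba⟩

theorem iSup_rpow_le_tsum {ι : Type*} (a : ι → ℝ≥0∞) {p : ℝ} (hp : 0 < p) :
    (⨆ i, a i) ^ p ≤ ∑' i, a i ^ p := by
  rw [← ENNReal.le_rpow_inv_iff hp]
  refine iSup_le fun i => ?_
  rw [ENNReal.le_rpow_inv_iff hp]
  exact ENNReal.le_tsum i

theorem maximal_enorm_le_translate_add {f : E → ℝ} (hf : Measurable f) (x h : E) :
    maximal μ (fun y => ‖f y‖ₑ) x ≤
      maximal μ (fun y => ‖f y‖ₑ) (x - h) + maximal μ (fun y => ‖f y - f (y - h)‖ₑ) x := by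
  rw [← maximal_comp_sub]
  refine (maximal_mono (fun y => ?_) x).trans (maximal_add_le (by fun_prop) _ x)
  simpa using enorm_add_le (f (y - h)) (f y - f (y - h))

theorem maximal_enorm_translate_le_add {f : E → ℝ} (hf : Measurable f) (x h : E) :
    maximal μ (fun y => ‖f y‖ₑ) (x - h) ≤
      maximal μ (fun y => ‖f y‖ₑ) x + maximal μ (fun y => ‖f y - f (y - h)‖ₑ) x := by
  rw [← maximal_comp_sub]
  refine (maximal_mono (fun y => ?_) x).trans (maximal_add_le (by fun_prop) _ x)
  simpa using enorm_sub_le (a := f y) (b := f y - f (y - h))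

/-- The truncated supremum of multiples of maximal functions, which is the test function for
capacities of superlevel sets. -/
noncomputable def truncatedMaximal (μ : Measure E) (c : ℕ → ℝ≥0∞) (g : ℕ → E → ℝ) (x : E) : ℝ :=
  (min 1 (⨆ i, c i * maximal μ (fun y => ‖g i y‖ₑ) x)).toReal

theorem measurable_truncatedMaximal (c : ℕ → ℝ≥0∞) (g : ℕ → E → ℝ) :
    Measurable (truncatedMaximal μ c g) :=
  (measurable_const.min (.iSup fun i => (measurable_maximal _).const_mul (c i))).ennreal_toReal

/-- The translation difference of the supremum is controlled by the supremum of the maximal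
functions of the differences of the `g i`. The maximal inequality then applies for each `h`
separately, and the weight is only a multiplier. -/
theorem energy_truncatedMaximal_le {c : ℕ → ℝ≥0∞} (hc : ∀ i, c i ≠ ∞) {g : ℕ → E → ℝ}
    (hg : ∀ i, Measurable (g i)) {p : ℝ} (hp : 1 < p) {w : E → ℝ≥0∞} (hw : Measurable w) :
    energy μ p w (truncatedMaximal μ c g) ≤
      maximalConst E p * ∑' i, c i ^ p * energy μ p w (g i) := by
  have hp0 : 0 < p := by linarith
  -- Used twice: for the `g i` themselves and for their translation differences.
  have key : ∀ v : ℕ → E → ℝ, (∀ i, Measurable (v i)) →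
      ∫⁻ x, (⨆ i, c i * maximal μ (fun y => ‖v i y‖ₑ) x) ^ p ∂μ ≤
        maximalConst E p * ∑' i, c i ^ p * ∫⁻ x, ‖v i x‖ₑ ^ p ∂μ := fun v hv => by
    calc _ ≤ ∫⁻ x, ∑' i, (c i * maximal μ (fun y => ‖v i y‖ₑ) x) ^ p ∂μ :=
          lintegral_mono fun x => iSup_rpow_le_tsum _ hp0
      _ = ∑' i, c i ^ p * ∫⁻ x, maximal μ (fun y => ‖v i y‖ₑ) x ^ p ∂μ := by
          rw [lintegral_tsum fun i =>
            (((measurable_maximal _).const_mul (c i)).pow_const p).aemeasurable]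
          congr! 2 with i
          simp_rw [ENNReal.mul_rpow_of_nonneg _ _ hp0.le]
          rw [lintegral_const_mul' _ _ (ENNReal.rpow_ne_top_of_nonneg hp0.le (hc i))]
      _ ≤ ∑' i, c i ^ p * (maximalConst E p * ∫⁻ x, ‖v i x‖ₑ ^ p ∂μ) := by
          refine ENNReal.tsum_le_tsum fun i => ?_
          gcongr
          exact lintegral_maximal_rpow_le (hv i).enorm hp
      _ = _ := by
          simp_rw [mul_left_comm _ (maximalConst E p)]
          rw [ENNReal.tsum_mul_left]
  have hfst : ∫⁻ x, ‖truncatedMaximal μ c g x‖ₑ ^ p ∂μ ≤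
      maximalConst E p * ∑' i, c i ^ p * ∫⁻ x, ‖g i x‖ₑ ^ p ∂μ := by
    refine (lintegral_mono fun x => ?_).trans (key g hg)
    beta_reduce
    gcongr
    simp [truncatedMaximal]
  have hsnd : ∀ h, ∫⁻ x, ‖truncatedMaximal μ c g x - truncatedMaximal μ c g (x - h)‖ₑ ^ p ∂μ ≤
      maximalConst E p * ∑' i, c i ^ p * ∫⁻ x, ‖g i x - g i (x - h)‖ₑ ^ p ∂μ := fun h => by
    refine (lintegral_mono fun x => ?_).trans
      (key (fun i x => g i x - g i (x - h)) fun i => by have := hg i; fun_prop)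
    beta_reduce
    gcongr
    have h1 : ∀ {a b d : ℕ → ℝ≥0∞}, (∀ i, a i ≤ b i + d i) →
        ⨆ i, c i * a i ≤ (⨆ i, c i * b i) + ⨆ i, c i * d i := fun {a b d} hi =>
      iSup_le fun i => (mul_le_mul_right (hi i) (c i)).trans <| by
        rw [mul_add]
        exact add_le_add (le_iSup (fun i => c i * b i) i) (le_iSup (fun i => c i * d i) i)
    exact enorm_toReal_min_one_sub_le (h1 fun i => maximal_enorm_le_translate_add (hg i) x h)
      (h1 fun i => maximal_enorm_translate_le_add (hg i) x h)
  calc energy μ p w (truncatedMaximal μ c g)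
      ≤ maximalConst E p * ∑' i, c i ^ p * ∫⁻ x, ‖g i x‖ₑ ^ p ∂μ +
        ∫⁻ h, maximalConst E p *
          ∑' i, c i ^ p * (w h * ∫⁻ x, ‖g i x - g i (x - h)‖ₑ ^ p ∂μ) ∂μ := by
        refine add_le_add hfst (lintegral_mono fun h => ?_)
        beta_reduce
        simp_rw [mul_left_comm _ (w h)]
        rw [ENNReal.tsum_mul_left, mul_left_comm]
        gcongr
        exact hsnd h
    _ = _ := by
        have hm : ∀ i, Measurable fun h => w h * ∫⁻ x, ‖g i x - g i (x - h)‖ₑ ^ p ∂μ := fun i =>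
          hw.mul (measurable_lintegral_sub_translate (hg i) p)
        rw [lintegral_const_mul' _ _ (by rw [maximalConst]; finiteness),
          lintegral_tsum fun i => ((hm i).const_mul _).aemeasurable, ← mul_add, ← ENNReal.tsum_add]
        congr! 3 with i
        rw [lintegral_const_mul _ (hm i), ← mul_add, energy]

theorem isOpen_lt_iSup_maximal (c : ℕ → ℝ≥0∞) (hc : ∀ i, c i ≠ ∞) (g : ℕ → E → ℝ≥0∞) :
    IsOpen {x | 1 < ⨆ i, c i * maximal μ (g i) x} := by
  have : {x | 1 < ⨆ i, c i * maximal μ (g i) x} = ⋃ i, {x | (c i)⁻¹ < maximal μ (g i) x} := by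
    ext x
    simp only [mem_ofPred_eq, lt_iSup_iff, mem_iUnion]
    congr! 2 with i
    rcases eq_or_ne (c i) 0 with h0 | h0
    · simp [h0]
    · rw [mul_comm, ← ENNReal.div_lt_iff (Or.inl h0) (Or.inl (hc i)), one_div]
  rw [this]
  exact isOpen_iUnion fun i => (lowerSemicontinuous_maximal (g i)).isOpen_preimage _

/-- Eventual closeness to convergent functions, with errors tending to `0`, forces `a` to be Cauchy
along `l`; the error bounds survive in the limit. -/
theorem exists_tendsto_of_forall_abs_sub_le {l : Filter ℝ} [l.NeBot] {a : ℝ → ℝ} {b : ℕ → ℝ → ℝ}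
    {β δ : ℕ → ℝ} (hδ : Tendsto δ atTop (𝓝 0)) (hb : ∀ i, Tendsto (b i) l (𝓝 (β i))) {m : ℕ}
    (hab : ∀ i ≥ m, ∀ᶠ r in l, |a r - b i r| ≤ δ i) :
    ∃ L, Tendsto a l (𝓝 L) ∧ ∀ i ≥ m, |L - β i| ≤ δ i := by
  have hcauchy : Cauchy (map a l) := by
    refine Metric.cauchy_iff.2 ⟨inferInstance, fun ε hε => ?_⟩
    obtain ⟨i, hi, him⟩ := ((hδ.eventually_lt_const (show 0 < ε / 4 by linarith)).and
      (eventually_ge_atTop m)).exists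
    refine ⟨ball (β i) (ε / 2), ?_, fun x hx y hy => ?_⟩
    · rw [mem_map]
      filter_upwards [hab i him, (hb i).eventually (ball_mem_nhds (β i) (ε := ε / 4)
        (by linarith))] with r h1 h2
      rw [mem_preimage, mem_ball, Real.dist_eq] at *
      linarith [abs_sub_le (a r) (b i r) (β i)]
    · rw [mem_ball] at *
      linarith [dist_triangle_right x y (β i)]
  obtain ⟨L, hL⟩ := CompleteSpace.complete hcauchy
  exact ⟨L, hL, fun i hi => le_of_tendsto ((Tendsto.sub hL (hb i)).abs) (hab i hi)⟩

end BallAverages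

/-! ### Capacity estimates and the exceptional sets. -/

section Capacity

open Metric

variable {n : ℕ} {s p : ℝ} {ω : EuclideanSpace ℝ (Fin n) → ℝ}

/-- The translation weight `ω(h) / |h| ^ (sp)` of the Sobolev seminorm. -/
noncomputable def kernelWeight (s p : ℝ) (ω : EuclideanSpace ℝ (Fin n) → ℝ)
    (h : EuclideanSpace ℝ (Fin n)) : ℝ≥0∞ :=
  ENNReal.ofReal (ω h / ‖h‖ ^ (s * p))

theorem measurable_kernelWeight (hω : Measurable ω) : Measurable (kernelWeight s p ω) := by
  unfold kernelWeight; fun_prop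

theorem eLpNorm_rpow_eq (hp : 0 < p) (f : EuclideanSpace ℝ (Fin n) → ℝ) :
    eLpNorm f (ENNReal.ofReal p) volume ^ p = ∫⁻ x, ‖f x‖ₑ ^ p := by
  rw [eLpNorm_eq_lintegral_rpow_enorm_toReal (by simpa using hp) ENNReal.ofReal_ne_top,
    ENNReal.toReal_ofReal hp.le, ← ENNReal.rpow_mul, one_div, inv_mul_cancel₀ hp.ne',
    ENNReal.rpow_one]

theorem seminormPow_congr_left {ω' : EuclideanSpace ℝ (Fin n) → ℝ} (h : ω =ᵐ[volume] ω')
    (f : EuclideanSpace ℝ (Fin n) → ℝ) : seminormPow s p ω f = seminormPow s p ω' f := by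
  refine lintegral_congr fun x => lintegral_congr_ae ?_
  filter_upwards [(quasiMeasurePreserving_sub_left volume x).ae h] with y hy
  rw [hy]

theorem normPow_congr_right {f g : EuclideanSpace ℝ (Fin n) → ℝ} (h : f =ᵐ[volume] g) :
    normPow s p ω f = normPow s p ω g := by
  unfold normPow seminormPow
  rw [eLpNorm_congr_ae h]
  congr 1
  refine lintegral_congr_ae ?_
  filter_upwards [h] with x hx
  refine lintegral_congr_ae ?_
  filter_upwards [h] with y hy
  rw [hx, hy]

theorem normPow_eq_energy (hp : 0 < p) (hω : Measurable ω) {f : EuclideanSpace ℝ (Fin n) → ℝ}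
    (hf : Measurable f) : normPow s p ω f = energy volume p (kernelWeight s p ω) f := by
  unfold normPow seminormPow energy
  rw [eLpNorm_rpow_eq hp]
  congr 1
  have hw := measurable_kernelWeight (s := s) (p := p) hω
  calc _ = ∫⁻ x, ∫⁻ h, kernelWeight s p ω h * ‖f x - f (x - h)‖ₑ ^ p := by
        refine lintegral_congr fun x => ?_
        rw [← lintegral_sub_left_eq_self _ x]
        refine lintegral_congr fun h => ?_
        rw [sub_sub_cancel, Real.enorm_eq_ofReal_abs, ENNReal.ofReal_rpow_of_nonneg (abs_nonneg _)
          hp.le, kernelWeight, ← ENNReal.ofReal_mul' (by positivity)]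
        congr 1
        ring
    _ = ∫⁻ h, ∫⁻ x, kernelWeight s p ω h * ‖f x - f (x - h)‖ₑ ^ p :=
        lintegral_lintegral_swap (Measurable.aemeasurable (by unfold Function.uncurry; fun_prop))
    _ = _ := by
        refine lintegral_congr fun h => ?_
        rw [lintegral_const_mul _ (by fun_prop)]

theorem capacity_mono {A B : Set (EuclideanSpace ℝ (Fin n))} (h : A ⊆ B) :
    capacity s p ω A ≤ capacity s p ω B :=
  biInf_mono fun _ ⟨hφ, V, hV, hBV, h1⟩ => ⟨hφ, V, hV, h.trans hBV, h1⟩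

/-- The capacitary weak type inequality for countably many maximal functions. -/
theorem capacity_lt_iSup_maximal_le (hp : 1 < p) (hω : Measurable ω) {c : ℕ → ℝ≥0∞}
    (hc : ∀ i, c i ≠ ∞) {g : ℕ → EuclideanSpace ℝ (Fin n) → ℝ} (hg : ∀ i, Measurable (g i)) :
    capacity s p ω {x | 1 < ⨆ i, c i * maximal volume (fun y => ‖g i y‖ₑ) x} ≤
      maximalConst (EuclideanSpace ℝ (Fin n)) p *
        ∑' i, c i ^ p * energy volume p (kernelWeight s p ω) (g i) := by
  have hp0 : 0 < p := by linarith
  set B := maximalConst (EuclideanSpace ℝ (Fin n)) p *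
    ∑' i, c i ^ p * energy volume p (kernelWeight s p ω) (g i)
  rcases eq_or_ne B ∞ with hB | hB
  · rw [hB]; exact le_top
  have hm := measurable_truncatedMaximal (μ := volume) c g
  have hle : normPow s p ω (truncatedMaximal volume c g) ≤ B := by
    rw [normPow_eq_energy hp0 hω hm]
    exact energy_truncatedMaximal_le hc hg hp (measurable_kernelWeight hω)
  have hlt := hle.trans_lt hB.lt_top
  -- The truncated supremum equals `1` on the superlevel set, which is open, so it is itself
  -- admissible.
  refine (iInf₂_le _ ⟨⟨⟨hm.aestronglyMeasurable, ?_⟩, hlt⟩, _, isOpen_lt_iSup_maximal c hc _,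
    subset_rfl, fun x hx => ?_⟩).trans hle
  · exact (ENNReal.rpow_lt_top_iff_of_pos hp0).1 (le_self_add.trans_lt hlt)
  · rw [truncatedMaximal, min_eq_left (le_of_lt hx), ENNReal.toReal_one]

/-- On a small ball `g` takes values in a closed ball about `g x`, and by convexity so does its
mean. -/
theorem tendsto_setAverage_ball_of_continuous {g : EuclideanSpace ℝ (Fin n) → ℝ}
    (hg : Continuous g) (x : EuclideanSpace ℝ (Fin n)) :
    Tendsto (fun t : ℝ => ⨍ y in ball x t, g y) (𝓝[>] 0) (𝓝 (g x)) := by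
  refine Metric.tendsto_nhds.2 fun ε hε => ?_
  obtain ⟨δ, hδ, h⟩ := Metric.continuous_iff.1 hg x (ε / 2) (by positivity)
  filter_upwards [Ioo_mem_nhdsGT hδ] with t ht
  have hmem := (convex_closedBall (g x) (ε / 2)).set_average_mem (μ := volume) (f := g)
    (t := ball x t) isClosed_closedBall (measure_ball_pos volume x ht.1).ne'
    measure_ball_lt_top.ne
    ((ae_restrict_iff' measurableSet_ball).2 <| Eventually.of_forall fun y hy =>
      (h y ((mem_ball.1 hy).trans ht.2)).le)
    (integrableOn_ball hg.locallyIntegrable x t)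
  exact (mem_closedBall.1 hmem).trans_lt (by linarith)

/-- Ball averages of a Sobolev function converge to a continuous function off open sets
of arbitrarily small capacity. -/
theorem exists_isOpen_capacity_tendsto (hp : 1 < p) (hω : Measurable ω)
    {f : EuclideanSpace ℝ (Fin n) → ℝ} (hfm : Measurable f) (hf : MemW s p ω f) :
    ∃ U : ℕ → Set (EuclideanSpace ℝ (Fin n)), (∀ m, IsOpen (U m)) ∧
      Tendsto (fun m => capacity s p ω (U m)) atTop (𝓝 0) ∧
      ∀ m, (∀ x ∉ U m, HasLimitRepAt f x) ∧ ContinuousOn (limitRep f) (U m)ᶜ := by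
  have hp0 : 0 < p := by linarith
  set w := kernelWeight s p ω
  have hE : energy volume p w f < ∞ := by
    rw [← normPow_eq_energy hp0 hω hfm]; exact hf.normPow_lt_top
  have hloc := locallyIntegrable_of_memLp hp hf.memLp
  have hconv := tendsto_energy_sub_setAverage_ball hfm hp hf.memLp (measurable_kernelWeight hω)
    (fun h => ENNReal.ofReal_ne_top) hE (r := fun k : ℕ => 1 / ((k : ℝ) + 1))
    (fun k => by positivity) tendsto_one_div_add_atTop_nhds_zero_nat
  -- The factor `2 ^ i` turns the threshold `1` of the weak type inequality into the bound `2^{-i}`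
  -- on the maximal function.
  set c : ℕ → ℝ≥0∞ := fun i => 2 ^ i
  have hc : ∀ i, c i ≠ ∞ := fun i => by simp [c]
  have hex : ∀ i : ℕ, ∃ r : ℝ, 0 < r ∧
      c i ^ p * energy volume p w (fun x => f x - ⨍ y in ball x r, f y) ≤ (2⁻¹) ^ i := fun i => by
    have h := ENNReal.Tendsto.const_mul hconv
      (Or.inr (ENNReal.rpow_ne_top_of_nonneg hp0.le (hc i)))
    rw [mul_zero] at h
    obtain ⟨k, hk⟩ := (h.eventually_lt_const (show (0 : ℝ≥0∞) < 2⁻¹ ^ i by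
      exact ENNReal.pow_pos (by simp) i)).exists
    exact ⟨_, by positivity, hk.le⟩
  choose r hr0 hr using hex
  set b : ℕ → EuclideanSpace ℝ (Fin n) → ℝ := fun i x => ⨍ y in ball x (r i), f y
  have hb : ∀ i, Continuous (b i) := fun i => continuous_setAverage_ball hloc (hr0 i)
  set g : ℕ → EuclideanSpace ℝ (Fin n) → ℝ := fun i x => f x - b i x
  have hg : ∀ i, Measurable (g i) := fun i => hfm.sub (hb i).measurable
  -- Only the indices from `m` on enter, so the capacity of `U m` is bounded by a tail of a
  -- geometric series.
  set U : ℕ → Set (EuclideanSpace ℝ (Fin n)) := fun m =>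
    {x | 1 < ⨆ i, c (i + m) * maximal volume (fun y => ‖g (i + m) y‖ₑ) x}
  have hclose : ∀ m, ∀ x ∉ U m, ∀ i ≥ m, ∀ t > 0,
      |(⨍ y in ball x t, f y) - ⨍ y in ball x t, b i y| ≤ (1 / 2) ^ i := by
    intro m x hx i hi t ht
    have h1 : c i * maximal volume (fun y => ‖g i y‖ₑ) x ≤ 1 := by
      have := (le_iSup (fun j => c (j + m) * maximal volume (fun y => ‖g (j + m) y‖ₑ) x)
        (i - m)).trans (not_lt.1 hx)
      simpa only [Nat.sub_add_cancel hi] using this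
    have h2 := (mul_le_mul_right (enorm_setAverage_ball_le (μ := volume) (g i) x ht) (c i)).trans h1
    rw [← setAverage_ball_sub hloc (hb i).locallyIntegrable, ← Real.norm_eq_abs,
      ← toReal_enorm]
    have h3 := ENNReal.toReal_mono ENNReal.one_ne_top h2
    rw [ENNReal.toReal_mul, ENNReal.toReal_one, ENNReal.toReal_pow, ENNReal.toReal_ofNat] at h3
    rw [one_div, inv_pow, ← one_div, le_div_iff₀' (by positivity)]
    exact h3
  have hblim : ∀ i x, Tendsto (fun t => ⨍ y in ball x t, b i y) (𝓝[>] 0) (𝓝 (b i x)) :=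
    fun i x => tendsto_setAverage_ball_of_continuous (hb i) x
  have hhalf : Tendsto (fun i : ℕ => (1 / 2 : ℝ) ^ i) atTop (𝓝 0) :=
    tendsto_pow_atTop_nhds_zero_of_lt_one (by norm_num) (by norm_num)
  have hlim : ∀ m, ∀ x ∉ U m, HasLimitRepAt f x ∧ ∀ i ≥ m, |limitRep f x - b i x| ≤ (1 / 2) ^ i := by
    intro m x hx
    obtain ⟨L, hL, hLb⟩ := exists_tendsto_of_forall_abs_sub_le hhalf (fun i => hblim i x)
      (fun i hi => (eventually_mem_nhdsWithin).mono fun t ht => hclose m x hx i hi t ht)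
    have : limitRep f x = L := hL.limUnder_eq
    rw [HasLimitRepAt, this]
    exact ⟨hL, hLb⟩
  refine ⟨U, fun m => isOpen_lt_iSup_maximal _ (fun i => hc _) _, ?_,
    fun m => ⟨fun x hx => (hlim m x hx).1, ?_⟩⟩
  · have hsum : ∑' i : ℕ, (2⁻¹ : ℝ≥0∞) ^ i ≠ ∞ := by
      rw [ENNReal.tsum_geometric]; simp
    have h := ENNReal.Tendsto.const_mul (ENNReal.tendsto_sum_nat_add _ hsum)
      (Or.inr (show maximalConst (EuclideanSpace ℝ (Fin n)) p ≠ ∞ from ENNReal.ofReal_ne_top))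
    rw [mul_zero] at h
    refine tendsto_of_tendsto_of_tendsto_of_le_of_le tendsto_const_nhds h (fun _ => zero_le)
      fun m => (capacity_lt_iSup_maximal_le hp hω (fun i => hc _) fun i => hg _).trans ?_
    beta_reduce
    gcongr with i
    exact hr _
  · have hu : TendstoUniformlyOn b (limitRep f) atTop (U m)ᶜ := by
      refine Metric.tendstoUniformlyOn_iff.2 fun ε hε => ?_
      filter_upwards [hhalf.eventually_lt_const hε, eventually_ge_atTop m] with i hi him x hx
      rw [Real.dist_eq]
      exact ((hlim m x hx).2 i him).trans_lt hi
    exact hu.continuousOn (Eventually.of_forall fun i => (hb i).continuousOn).frequently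

/-- Norm, capacity and ball averages depend only on the almost everywhere classes of `ω` and `f`, so
both may be replaced by measurable representatives. -/
theorem exists_isOpen_capacity_tendsto_of_aestronglyMeasurable (hp : 1 < p)
    (hω : AEStronglyMeasurable ω volume) {f : EuclideanSpace ℝ (Fin n) → ℝ} (hf : MemW s p ω f) :
    ∃ U : ℕ → Set (EuclideanSpace ℝ (Fin n)), (∀ m, IsOpen (U m)) ∧
      Tendsto (fun m => capacity s p ω (U m)) atTop (𝓝 0) ∧
      ∀ m, (∀ x ∉ U m, HasLimitRepAt f x) ∧ ContinuousOn (limitRep f) (U m)ᶜ := by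
  set ω' := hω.mk ω
  set f' := hf.memLp.1.mk f
  have hff' : f =ᵐ[volume] f' := hf.memLp.1.ae_eq_mk
  have hnorm : ∀ φ, normPow s p ω φ = normPow s p ω' φ := fun φ => by
    rw [normPow, normPow, seminormPow_congr_left hω.ae_eq_mk]
  have hmem : ∀ φ, MemW s p ω φ ↔ MemW s p ω' φ := fun φ =>
    ⟨fun h => ⟨h.1, hnorm φ ▸ h.2⟩, fun h => ⟨h.1, hnorm φ ▸ h.2⟩⟩
  have hcap : ∀ A, capacity s p ω A = capacity s p ω' A := fun A => by
    simp only [capacity, admissible, hmem, hnorm]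
  have havg : ∀ x r, ⨍ y in ball x r, f y = ⨍ y in ball x r, f' y := fun x r =>
    average_congr (ae_restrict_of_ae hff')
  have hrep : limitRep f = limitRep f' := by
    funext x; simp only [limitRep, havg]
  have hrepAt : ∀ x, HasLimitRepAt f x ↔ HasLimitRepAt f' x := fun x => by
    simp only [HasLimitRepAt, havg, hrep]
  have hf' : MemW s p ω' f' := (hmem f').1
    ⟨hf.memLp.ae_eq hff', normPow_congr_right (ω := ω) hff' ▸ hf.normPow_lt_top⟩
  simp only [hcap, hrep, hrepAt]
  exact exists_isOpen_capacity_tendsto hp hω.stronglyMeasurable_mk.measurable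
    hf.memLp.1.stronglyMeasurable_mk.measurable hf'

end Capacity

end FracSobolev

theorem theorem6p2 (n : ℕ) (s p : ℝ) (hs : 0 < s) (hs1 : s < 1) (hp : 1 < p)
    (ω : EuclideanSpace ℝ (Fin n) → ℝ) (hω : FracSobolev.IsApWeight p ω)
    (hsmooth : ∀ φ : EuclideanSpace ℝ (Fin n) → ℝ,
      ContDiff ℝ ((⊤ : ℕ∞) : WithTop ℕ∞) φ → HasCompactSupport φ → FracSobolev.MemW s p ω φ)
    (f : EuclideanSpace ℝ (Fin n) → ℝ) (hf : FracSobolev.MemW s p ω f) :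
    (∃ E : Set (EuclideanSpace ℝ (Fin n)), IsGδ E ∧ FracSobolev.capacity s p ω E = 0 ∧
      ∀ x ∉ E, FracSobolev.HasLimitRepAt f x) ∧
    ∀ ε : ℝ, 0 < ε → ∃ U : Set (EuclideanSpace ℝ (Fin n)), IsOpen U ∧
      FracSobolev.capacity s p ω U < ENNReal.ofReal ε ∧
      (∀ x ∉ U, FracSobolev.HasLimitRepAt f x) ∧
      ContinuousOn (FracSobolev.limitRep f) Uᶜ := by
  obtain ⟨U, hUo, hUc, hU⟩ :=
    FracSobolev.exists_isOpen_capacity_tendsto_of_aestronglyMeasurable hp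
      hω.locallyIntegrable.aestronglyMeasurable hf
  -- The exceptional set is the intersection of the `U m`: a point outside it misses some `U m`, and
  -- monotonicity makes its capacity zero.
  refine ⟨⟨⋂ m, U m, .iInter_of_isOpen hUo, ?_, fun x hx => ?_⟩, fun ε hε => ?_⟩
  · exact le_antisymm (ge_of_tendsto' hUc fun m =>
      FracSobolev.capacity_mono (iInter_subset U m)) zero_le
  · obtain ⟨m, hm⟩ := not_forall.1 (mt mem_iInter.2 hx)
    exact (hU m).1 x hm
  · obtain ⟨m, hm⟩ := (hUc.eventually_lt_const (ENNReal.ofReal_pos.2 hε)).exists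
    exact ⟨U m, hUo m, hm, hU m⟩
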